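/- Let $V$ be a separable right quaternionic Hilbert space, and let $\mathcal B(V)$ be the set of bounded right $\mathbb H$-linear operators on $V$. An operator $A\in\mathcal B(V)$ is Fredholm, $A\in\mathcal F(V)$, if $\ker A$ and $\operatorname{coker}A=V/\operatorname{ran}A$ are finite dimensional over $\mathbb H$; its index is then $\operatorname{ind}A=\dim\ker A-\dim\operatorname{coker}A$. The set of Weyl operators is $\mathcal W(V)=\{A\in\mathcal F(V)\mid \operatorname{ind}A=0\}$. For $A\in\mathcal B(V)$ and $\mathfrak q\in\mathbb H$ put $R_{\mathfrak q}(A)=A^2-2\operatorname{Re}(\mathfrak q)A+|\mathfrak q|^2 I$. The S-resolvent set $\rho_S(A)$ is the set of all $\mathfrak q\in\mathbb H$ such that $\ker R_{\mathfrak q}(A)=\{0\}$, $\operatorname{ran}R_{\mathfrak q}(A)$ is dense in $V$, and $R_{\mathfrak q}(A)^{-1}:\operatorname{ran}R_{\mathfrak q}(A)\to V$ is bounded; the S-spectrum is $\sigma_S(A)=\mathbb H\setminus\rho_S(A)$, and $\sigma_0^S(A)=\{\mathfrak q\in\sigma_S(A)\mid R_{\mathfrak q}(A)\in\mathcal W(V)\}$.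 Then $$\mathcal W(V)=\{A\in\mathcal B(V)\mid 0\in\rho_S(A)\cup\sigma_0^S(A)\}=\{A\in\mathcal F(V)\mid 0\in\rho_S(A)\cup\sigma_0^S(A)\}.$$ -/

import Mathlib

open scoped Quaternion

namespace QuaternionicWeyl

/-- The inner product structure of a right quaternionic (pre-)Hilbert space. The right scalar
multiplication `φ q` of the space is `MulOpposite.op q • φ`, that is, `V` is a module over the
opposite ring `ℍᵐᵒᵖ`. The inner product takes values in the quaternions, is linear in its second
variable, and induces the norm of `V`. -/
class RightInnerProductSpace (V : Type*) [NormedAddCommGroup V] [Module ℍᵐᵒᵖ V] extends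
    Inner ℍ V where
  /-- Hermitian symmetry. -/
  star_inner : ∀ φ ψ : V, star (inner φ ψ) = inner ψ φ
  /-- The norm is the one of the inner product; in particular the form is positive definite. -/
  inner_self : ∀ φ : V, inner φ φ = ((‖φ‖ ^ 2 : ℝ) : ℍ)
  inner_add_right : ∀ φ ψ ω : V, inner φ (ψ + ω) = inner φ ψ + inner φ ω
  inner_op_smul_right : ∀ (φ ψ : V) (q : ℍ), inner φ (MulOpposite.op q • ψ) = inner φ ψ * q

/-- Conjugate homogeneity in the first variable follows from the other laws. -/
theorem inner_op_smul_left {V : Type*} [NormedAddCommGroup V] [Module ℍᵐᵒᵖ V]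
    [RightInnerProductSpace V] (φ ψ : V) (q : ℍ) :
    inner ℍ (MulOpposite.op q • φ) ψ = star q * inner ℍ φ ψ := by
  rw [← RightInnerProductSpace.star_inner ψ, RightInnerProductSpace.inner_op_smul_right,
    star_mul, RightInnerProductSpace.star_inner]

section Fredholm

variable {V U : Type*} [NormedAddCommGroup V] [Module ℍᵐᵒᵖ V]
  [NormedAddCommGroup U] [Module ℍᵐᵒᵖ U]

/-- A bounded right linear operator `A` is Fredholm if `ker A` and `coker A = U / ran A` are
finite dimensional (over the quaternions). -/
def IsFredholm (A : V →L[ℍᵐᵒᵖ] U) : Prop :=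
  FiniteDimensional ℍᵐᵒᵖ (LinearMap.ker (A : V →ₗ[ℍᵐᵒᵖ] U)) ∧
    FiniteDimensional ℍᵐᵒᵖ (U ⧸ LinearMap.range (A : V →ₗ[ℍᵐᵒᵖ] U))

/-- `ind A = dim (ker A) - dim (coker A)`; only meaningful for a Fredholm operator `A`. -/
noncomputable def index (A : V →L[ℍᵐᵒᵖ] U) : ℤ :=
  (Module.finrank ℍᵐᵒᵖ (LinearMap.ker (A : V →ₗ[ℍᵐᵒᵖ] U)) : ℤ) -
    (Module.finrank ℍᵐᵒᵖ (U ⧸ LinearMap.range (A : V →ₗ[ℍᵐᵒᵖ] U)) : ℤ)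

end Fredholm

/-- The set of all Fredholm operators on `V`. -/
def fredholmOperators (V : Type*) [NormedAddCommGroup V] [Module ℍᵐᵒᵖ V] :
    Set (V →L[ℍᵐᵒᵖ] V) :=
  {A | IsFredholm A}

/-- The set of all Weyl operators on `V`: the Fredholm operators of index zero. -/
def weylOperators (V : Type*) [NormedAddCommGroup V] [Module ℍᵐᵒᵖ V] :
    Set (V →L[ℍᵐᵒᵖ] V) :=
  {A | A ∈ fredholmOperators V ∧ index A = 0}

section Spectrum

/- The real scalar multiplication of `V` is the restriction of the quaternionic one, by
`IsScalarTower ℝ ℍᵐᵒᵖ V`. -/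
variable {V : Type*} [NormedAddCommGroup V] [NormedSpace ℝ V] [Module ℍᵐᵒᵖ V]
  [IsScalarTower ℝ ℍᵐᵒᵖ V]

/-- The pseudo-resolvent operator `R_q(A) = A² - 2 Re(q) A + |q|² I`. -/
noncomputable def pseudoResolvent (q : ℍ) (A : V →L[ℍᵐᵒᵖ] V) : V →L[ℍᵐᵒᵖ] V :=
  A ^ 2 - (2 * q.re) • A + (‖q‖ ^ 2) • (1 : V →L[ℍᵐᵒᵖ] V)

/-- The S-resolvent set of `A`: the `q` for which `R_q(A)` has trivial kernel, dense range, and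
an inverse `ran (R_q(A)) → V` that is bounded. -/
def sResolventSet (A : V →L[ℍᵐᵒᵖ] V) : Set ℍ :=
  {q | LinearMap.ker (pseudoResolvent q A : V →ₗ[ℍᵐᵒᵖ] V) = ⊥ ∧
    Dense (Set.range (pseudoResolvent q A)) ∧
    ∃ K : ℝ, ∀ φ : V, ‖φ‖ ≤ K * ‖pseudoResolvent q A φ‖}

/-- The S-spectrum of `A`. -/
def sSpectrum (A : V →L[ℍᵐᵒᵖ] V) : Set ℍ :=
  (sResolventSet A)ᶜ

/-- The part `σ₀ˢ(A)` of the S-spectrum: the `q` in it for which `R_q(A)` is a Weyl operator. -/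
def sigmaZero (A : V →L[ℍᵐᵒᵖ] V) : Set ℍ :=
  {q | q ∈ sSpectrum A ∧ pseudoResolvent q A ∈ weylOperators V}

end Spectrum

end QuaternionicWeyl

namespace QuaternionicWeyl

variable {V : Type*} [NormedAddCommGroup V] [Module ℍᵐᵒᵖ V]

/-! At `q = 0` the pseudo-resolvent is `A²`. For every `q`, membership in the union says exactly
that `R_q(A)` is Weyl: on the S-resolvent set `R_q(A)` is bijective (`bijective_of_bounded_below`),
hence Weyl. It remains that `A²` is Weyl iff `A` is (`comp_self_mem_weylOperators_iff`), because
`ind A² = 2 ind A`. -/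

theorem mem_weylOperators_iff {A : V →L[ℍᵐᵒᵖ] V} :
    A ∈ weylOperators V ↔ IsFredholm A ∧ (A : V →ₗ[ℍᵐᵒᵖ] V).index = 0 :=
  Iff.rfl

/-- Forward: `ker A ⊆ ker A²`, and `V / ran A` is a quotient of `V / ran A²`. Backward: `ker A²` is
the preimage of `ker A` under `A`, and `ran A²` the image of `ran A`. -/
theorem isFredholm_comp_self_iff {A : V →L[ℍᵐᵒᵖ] V} : IsFredholm (A ∘L A) ↔ IsFredholm A := by
  constructor
  · rintro ⟨hker, hcoker⟩
    rw [ContinuousLinearMap.toLinearMap_comp] at hker hcoker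
    refine ⟨?_, ?_⟩
    · exact Submodule.finiteDimensional_of_le
        (LinearMap.ker_le_ker_comp (A : V →ₗ[ℍᵐᵒᵖ] V) (A : V →ₗ[ℍᵐᵒᵖ] V))
    · exact Module.Finite.of_surjective _ (Submodule.factor_surjective
        (LinearMap.range_comp_le_range (A : V →ₗ[ℍᵐᵒᵖ] V) (A : V →ₗ[ℍᵐᵒᵖ] V)))
  · rintro ⟨hker, hcoker⟩
    refine ⟨?_, ?_⟩
    · rw [ContinuousLinearMap.toLinearMap_comp, LinearMap.ker_comp]
      infer_instance
    · rw [ContinuousLinearMap.toLinearMap_comp, LinearMap.range_comp]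
      infer_instance

theorem comp_self_mem_weylOperators_iff {A : V →L[ℍᵐᵒᵖ] V} :
    A ∘L A ∈ weylOperators V ↔ A ∈ weylOperators V := by
  rw [mem_weylOperators_iff, mem_weylOperators_iff, isFredholm_comp_self_iff]
  refine and_congr_right fun ⟨hker, hcoker⟩ => ?_
  rw [ContinuousLinearMap.toLinearMap_comp, LinearMap.index_comp]
  omega

theorem mem_weylOperators_of_bijective {A : V →L[ℍᵐᵒᵖ] V} (hA : Function.Bijective A) :
    A ∈ weylOperators V := by
  have hker : LinearMap.ker (A : V →ₗ[ℍᵐᵒᵖ] V) = ⊥ := LinearMap.ker_eq_bot.2 hA.1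
  have hrange : LinearMap.range (A : V →ₗ[ℍᵐᵒᵖ] V) = ⊤ := LinearMap.range_eq_top.2 hA.2
  refine mem_weylOperators_iff.2 ⟨⟨?_, ?_⟩, ?_⟩
  · rw [hker]
    infer_instance
  · rw [hrange]
    infer_instance
  · exact (LinearEquiv.ofBijective (A : V →ₗ[ℍᵐᵒᵖ] V) hA).index_eq_zero

/-- The lower bound gives injectivity and, by completeness, a closed range; being dense as well, the
range is all of `V`. -/
theorem bijective_of_bounded_below [CompleteSpace V] {A : V →L[ℍᵐᵒᵖ] V}
    (hdense : DenseRange A) {K : ℝ} (hK : ∀ φ : V, ‖φ‖ ≤ K * ‖A φ‖) :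
    Function.Bijective A := by
  have hanti : AntilipschitzWith K.toNNReal A :=
    -- `K` carries no sign condition, so it is enlarged to its nonnegative part.
    AddMonoidHomClass.antilipschitz_of_bound A fun φ => (hK φ).trans
      (mul_le_mul_of_nonneg_right (Real.le_coe_toNNReal K) (norm_nonneg _))
  refine ⟨hanti.injective, fun φ => ?_⟩
  rw [← Set.mem_range, ← (hanti.isClosed_range A.uniformContinuous).closure_eq]
  exact hdense φ

variable [NormedSpace ℝ V] [IsScalarTower ℝ ℍᵐᵒᵖ V]

theorem pseudoResolvent_zero (A : V →L[ℍᵐᵒᵖ] V) : pseudoResolvent 0 A = A ∘L A := by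
  simp [pseudoResolvent, pow_two, ContinuousLinearMap.mul_def]

theorem pseudoResolvent_mem_weylOperators [CompleteSpace V] {A : V →L[ℍᵐᵒᵖ] V} {q : ℍ}
    (hq : q ∈ sResolventSet A) : pseudoResolvent q A ∈ weylOperators V := by
  obtain ⟨-, hdense, K, hK⟩ := hq
  exact mem_weylOperators_of_bijective (bijective_of_bounded_below hdense hK)

theorem mem_sResolventSet_union_sigmaZero_iff [CompleteSpace V] {A : V →L[ℍᵐᵒᵖ] V} {q : ℍ} :
    q ∈ sResolventSet A ∪ sigmaZero A ↔ pseudoResolvent q A ∈ weylOperators V := by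
  constructor
  · rintro (hq | hq)
    · exact pseudoResolvent_mem_weylOperators hq
    · exact hq.2
  · intro hq
    by_cases h : q ∈ sResolventSet A
    · exact Or.inl h
    · exact Or.inr ⟨h, hq⟩

end QuaternionicWeyl

theorem proposition6p9 {V : Type*} [NormedAddCommGroup V] [NormedSpace ℝ V] [Module ℍᵐᵒᵖ V]
    [IsScalarTower ℝ ℍᵐᵒᵖ V] [QuaternionicWeyl.RightInnerProductSpace V] [CompleteSpace V]
    [TopologicalSpace.SeparableSpace V] :
    QuaternionicWeyl.weylOperators V =
        {A : V →L[ℍᵐᵒᵖ] V |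
          (0 : ℍ) ∈ QuaternionicWeyl.sResolventSet A ∪ QuaternionicWeyl.sigmaZero A} ∧
      {A : V →L[ℍᵐᵒᵖ] V |
          (0 : ℍ) ∈ QuaternionicWeyl.sResolventSet A ∪ QuaternionicWeyl.sigmaZero A} =
        {A : V →L[ℍᵐᵒᵖ] V | A ∈ QuaternionicWeyl.fredholmOperators V ∧
          (0 : ℍ) ∈ QuaternionicWeyl.sResolventSet A ∪ QuaternionicWeyl.sigmaZero A} := by
  have key : ∀ A : V →L[ℍᵐᵒᵖ] V,
      (0 : ℍ) ∈ QuaternionicWeyl.sResolventSet A ∪ QuaternionicWeyl.sigmaZero A ↔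
        A ∈ QuaternionicWeyl.weylOperators V := fun A => by
    rw [QuaternionicWeyl.mem_sResolventSet_union_sigmaZero_iff,
      QuaternionicWeyl.pseudoResolvent_zero, QuaternionicWeyl.comp_self_mem_weylOperators_iff]
  refine ⟨Set.ext fun A => (key A).symm, Set.ext fun A => ?_⟩
  exact ⟨fun h => ⟨((key A).1 h).1, h⟩, fun h => h.2⟩
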